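/- Let $\Bbbk$ be an algebraically closed field of characteristic $0$ and let $n\ge 2$. Let $X=\operatorname{Spec} A$ with $A=\Bbbk[T_{ij}]_{1\le i,j\le n}/(T_{ij}-T_{ji})_{1\le i,j\le n}$ be the affine variety of symmetric $n\times n$ matrices over $\Bbbk$. For $i\neq j$ let $E_{ij}$ be the matrix with entry $1$ in position $(i,j)$ and all other entries $0$. The one-parameter group $H_{ij}=\{I_n+tE_{ij} : t\in\Bbbk\}$ acts on $X$ by $B\mapsto (I_n+tE_{ij})\,B\,(I_n+tE_{ij})^T$. Let $\delta_{ij}$ be the corresponding locally nilpotent derivation of $A$, which is determined by letting $\delta_{ij}(T_{ab})$ be the $(a,b)$ entry of $E_{ij}T+TE_{ij}^T$, where $T=(T_{ab})$ is the generic symmetric matrix. The replicas of $H_{ij}$ are the one-parameter groups $\{\exp(t f\delta_{ij}) : t\in\Bbbk\}\subseteq\operatorname{Aut}(X)$ with $f\in\ker\delta_{ij}$, where $\exp(tf\delta_{ij})$ is the automorphism of $X$ whose comorphism is $a\mapsto\sum_{m\ge 0}\frac{t^m}{m!}(f\delta_{ij})^m(a)$; for $f=1$ this is the action of $H_{ij}$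 itself. Let $G_{\rm sym}\subseteq\operatorname{Aut}(X)$ be the subgroup generated by all $H_{ij}$ ($i\ne j$) along with all their replicas. Let $M_1,\dots,M_k$ be pairwise distinct symmetric $n\times n$ matrices over $\Bbbk$, and let $M_1',\dots,M_k'$ be another sequence of pairwise distinct symmetric $n\times n$ matrices over $\Bbbk$, such that $$\operatorname{rk}(M_i)=\operatorname{rk}(M_i')\ge 2\quad\text{and}\quad \det(M_i)=\det(M_i')\qquad\text{for all } i=1,\dots,k.$$ Then there exists an automorphism $g\in G_{\rm sym}$ with $g.M_i=M_i'$ for all $i=1,\dots,k$. -/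

import Mathlib

namespace SymMat

section LocallyNilpotent

variable {K A : Type*} [Field K] [CommRing A] [Algebra K A]

/-- A derivation `D` of a `K`-algebra is locally nilpotent if every element is killed by some
power of `D`. -/
def IsLocallyNilpotent (D : Derivation K A A) : Prop :=
  ∀ a : A, ∃ N : ℕ, D^[N] a = 0

theorem iterate_eq_zero_of_le {D : Derivation K A A} {a : A} {N m : ℕ} (h : D^[N] a = 0)
    (hm : N ≤ m) : D^[m] a = 0 := by
  obtain ⟨k, rfl⟩ := Nat.exists_eq_add_of_le' hm
  rw [Function.iterate_add_apply, h, iterate_map_zero]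

/-- The iterated Leibniz rule. -/
theorem iterate_mul (D : Derivation K A A) (n : ℕ) (a b : A) :
    D^[n] (a * b) =
      ∑ ij ∈ Finset.HasAntidiagonal.antidiagonal n, n.choose ij.1 • (D^[ij.1] a * D^[ij.2] b) := by
  induction n with
  | zero => simp
  | succ n ih =>
    rw [Function.iterate_succ_apply', ih, map_sum]
    rw [Finset.sum_antidiagonal_choose_succ_nsmul (M := A)
      (fun i j => D^[i] a * D^[j] b) n]
    rw [← Finset.sum_add_distrib]
    refine Finset.sum_congr rfl fun ij hij => ?_
    have hc : n.choose ij.2 = n.choose ij.1 := by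
      rw [← Finset.HasAntidiagonal.mem_antidiagonal.1 hij, Nat.choose_symm_add]
    rw [map_nsmul, Derivation.leibniz, hc]
    simp only [Function.iterate_succ_apply', smul_eq_mul, smul_add]
    rw [mul_comm (D^[ij.2] b)]

theorem exists_iterate_mul_eq_zero {D : Derivation K A A} {a b : A}
    (ha : ∃ N : ℕ, D^[N] a = 0) (hb : ∃ N : ℕ, D^[N] b = 0) : ∃ N : ℕ, D^[N] (a * b) = 0 := by
  obtain ⟨p, hp⟩ := ha
  obtain ⟨q, hq⟩ := hb
  refine ⟨p + q, ?_⟩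
  rw [iterate_mul]
  refine Finset.sum_eq_zero fun ij hij => ?_
  have h := Finset.HasAntidiagonal.mem_antidiagonal.1 hij
  rcases le_or_gt p ij.1 with h1 | h1
  · rw [iterate_eq_zero_of_le hp h1, zero_mul, smul_zero]
  · rw [iterate_eq_zero_of_le hq (by omega), mul_zero, smul_zero]

/-- For `f ∈ ker D` the derivation `f • D` is again locally nilpotent. -/
theorem IsLocallyNilpotent.replica {D : Derivation K A A} (hD : IsLocallyNilpotent D) {f : A}
    (hf : D f = 0) : IsLocallyNilpotent (f • D) := by
  have key : ∀ (n : ℕ) (a : A), (f • D)^[n] a = f ^ n * D^[n] a := by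
    intro n a
    induction n with
    | zero => simp
    | succ n ih =>
      have h0 : D (f ^ n) = 0 := by rw [Derivation.leibniz_pow, hf]; simp
      rw [Function.iterate_succ_apply', ih, Function.iterate_succ_apply',
        Derivation.smul_apply, Derivation.leibniz, h0]
      simp only [smul_eq_mul, mul_zero, add_zero]
      ring
  intro a
  obtain ⟨N, hN⟩ := hD a
  exact ⟨N, by rw [key, hN, mul_zero]⟩

open Classical in
/-- The polynomial `∑ (m!)⁻¹ • D^m a * T^m` in the time variable `T`; the sum is finite because
`D` is locally nilpotent. -/
noncomputable def flowPoly {D : Derivation K A A} (hD : IsLocallyNilpotent D) (a : A) :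
    Polynomial A :=
  ∑ m ∈ Finset.range (Nat.find (hD a)),
    Polynomial.monomial m (((m.factorial : K)⁻¹) • D^[m] a)

theorem coeff_flowPoly {D : Derivation K A A} (hD : IsLocallyNilpotent D) (a : A) (m : ℕ) :
    (flowPoly hD a).coeff m = ((m.factorial : K)⁻¹) • D^[m] a := by
  classical
  rw [flowPoly, Polynomial.finsetSum_coeff]
  simp only [Polynomial.coeff_monomial]
  rw [Finset.sum_ite_eq' (Finset.range _)]
  split_ifs with h
  · rfl
  · rw [iterate_eq_zero_of_le (Nat.find_spec (hD a)) (by simpa using h), smul_zero]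

/-- The value at `a` of `exp (t D)`, i.e. the finite sum `∑ (t ^ m / m!) • D^m a`. -/
noncomputable def expFun {D : Derivation K A A} (hD : IsLocallyNilpotent D) (t : K) (a : A) : A :=
  (flowPoly hD a).eval (algebraMap K A t)

theorem expFun_eq_sum {D : Derivation K A A} (hD : IsLocallyNilpotent D) (t : K) (a : A) {N : ℕ}
    (hN : D^[N] a = 0) :
    expFun hD t a = ∑ m ∈ Finset.range N, (t ^ m / (m.factorial : K)) • D^[m] a := by
  have hdeg : (flowPoly hD a).natDegree < N + 1 := by
    refine Nat.lt_succ_of_le (Polynomial.natDegree_le_iff_coeff_eq_zero.2 fun m hm => ?_)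
    rw [coeff_flowPoly, iterate_eq_zero_of_le hN hm.le, smul_zero]
  rw [expFun, Polynomial.eval_eq_sum_range' hdeg, Finset.sum_range_succ, coeff_flowPoly, hN,
    smul_zero, zero_mul, add_zero]
  refine Finset.sum_congr rfl fun m _ => ?_
  rw [coeff_flowPoly, ← map_pow, mul_comm, ← Algebra.smul_def, smul_smul, div_eq_mul_inv]

variable [CharZero K]

theorem flowPoly_mul {D : Derivation K A A} (hD : IsLocallyNilpotent D) (a b : A) :
    flowPoly hD (a * b) = flowPoly hD a * flowPoly hD b := by
  ext m
  rw [Polynomial.coeff_mul, coeff_flowPoly, iterate_mul, Finset.smul_sum]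
  refine Finset.sum_congr rfl fun ij hij => ?_
  have h := Finset.HasAntidiagonal.mem_antidiagonal.1 hij
  rw [coeff_flowPoly, coeff_flowPoly, smul_mul_smul_comm, ← Nat.cast_smul_eq_nsmul K, smul_smul]
  congr 1
  have h1 : ((m.factorial : ℕ) : K) ≠ 0 := Nat.cast_ne_zero.2 m.factorial_ne_zero
  have h2 : ((ij.1.factorial : ℕ) : K) ≠ 0 := Nat.cast_ne_zero.2 (Nat.factorial_ne_zero _)
  have h3 : ((ij.2.factorial : ℕ) : K) ≠ 0 := Nat.cast_ne_zero.2 (Nat.factorial_ne_zero _)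
  have h4 : ((m.choose ij.1 : ℕ) : K) * ij.1.factorial * ij.2.factorial = m.factorial := by
    rw [← h, Nat.choose_symm_add]
    exact_mod_cast Nat.add_choose_mul_factorial_mul_factorial ij.1 ij.2
  field_simp
  linear_combination h4

theorem flowPoly_expFun {D : Derivation K A A} (hD : IsLocallyNilpotent D) (t : K) (a : A) :
    flowPoly hD (expFun hD t a) = Polynomial.taylor (algebraMap K A t) (flowPoly hD a) := by
  obtain ⟨N, hN⟩ := hD a
  have hdeg : ∀ i, (Polynomial.hasseDeriv i (flowPoly hD a)).natDegree < N + 1 := by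
    intro i
    refine Nat.lt_succ_of_le (Polynomial.natDegree_le_iff_coeff_eq_zero.2 fun m hm => ?_)
    rw [Polynomial.hasseDeriv_coeff, coeff_flowPoly, iterate_eq_zero_of_le hN (by omega),
      smul_zero, mul_zero]
  ext i
  rw [Polynomial.taylor_coeff, coeff_flowPoly,
    expFun_eq_sum hD t a (iterate_eq_zero_of_le hN (Nat.le_succ N)),
    Polynomial.eval_eq_sum_range' (hdeg i)]
  have hlin : ∀ x : A, D^[i] x = ((D : A →ₗ[K] A) ^ i) x := fun x => by
    rw [Module.End.pow_apply]; rfl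
  rw [hlin, map_sum, Finset.smul_sum]
  refine Finset.sum_congr rfl fun m _ => ?_
  rw [map_smul, ← hlin, ← Function.iterate_add_apply, Polynomial.hasseDeriv_coeff,
    coeff_flowPoly, ← map_pow, mul_comm, ← Algebra.smul_def, add_comm i m,
    ← map_natCast (algebraMap K A), ← Algebra.smul_def, smul_smul, smul_smul, smul_smul]
  congr 1
  have h1 : (((m + i).factorial : ℕ) : K) ≠ 0 := Nat.cast_ne_zero.2 (Nat.factorial_ne_zero _)
  have h2 : ((i.factorial : ℕ) : K) ≠ 0 := Nat.cast_ne_zero.2 (Nat.factorial_ne_zero _)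
  have h3 : ((m.factorial : ℕ) : K) ≠ 0 := Nat.cast_ne_zero.2 (Nat.factorial_ne_zero _)
  have h4 : (((m + i).choose i : ℕ) : K) * m.factorial * i.factorial = (m + i).factorial := by
    exact_mod_cast Nat.add_choose_mul_factorial_mul_factorial m i
  field_simp
  linear_combination (-t ^ m) * h4

theorem expFun_neg_expFun {D : Derivation K A A} (hD : IsLocallyNilpotent D) (t : K) (a : A) :
    expFun hD (-t) (expFun hD t a) = a := by
  rw [expFun, flowPoly_expFun, Polynomial.taylor_eval, map_neg, neg_add_cancel,
    ← Polynomial.coeff_zero_eq_eval_zero, coeff_flowPoly]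
  simp

/-- The automorphism `exp (t D) = ∑ (t ^ m / m!) • D ^ m` of the algebra `A`. -/
noncomputable def exp {D : Derivation K A A} (hD : IsLocallyNilpotent D) (t : K) : A ≃ₐ[K] A where
  toFun := expFun hD t
  invFun := expFun hD (-t)
  left_inv := expFun_neg_expFun hD t
  right_inv a := by simpa using expFun_neg_expFun hD (-t) a
  map_mul' a b := by simp [expFun, flowPoly_mul]
  map_add' a b := by
    have : flowPoly hD (a + b) = flowPoly hD a + flowPoly hD b := by
      ext m
      rw [Polynomial.coeff_add, coeff_flowPoly, coeff_flowPoly, coeff_flowPoly,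
        iterate_map_add, smul_add]
    simp [expFun, this]
  commutes' r := by
    rw [expFun_eq_sum hD t _ (N := 1) (by simp)]
    simp

end LocallyNilpotent

section Symmetric

variable (n : ℕ) (K : Type*) [Field K]

/-- The coordinate ring `K[T_ij] / (T_ij - T_ji)` of the variety of symmetric `n × n` matrices:
the polynomial ring with one variable `T_ij = T_ji` for each unordered pair `{i, j}` of indices
(`i = j` allowed). -/
abbrev CoordRing : Type _ := MvPolynomial (Sym2 (Fin n)) K

/-- The automorphism group of the affine variety of symmetric matrices. A morphism corresponds
contravariantly to its comorphism on the coordinate ring, hence the opposite group. -/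
abbrev Aut : Type _ := (CoordRing n K ≃ₐ[K] CoordRing n K)ᵐᵒᵖ

/-- The points of the variety: symmetric `n × n` matrices over `K`. -/
abbrev Point : Type _ := {M : Matrix (Fin n) (Fin n) K // M.IsSymm}

variable {n K}

/-- Evaluation of regular functions at a symmetric matrix. -/
noncomputable def evalAt (M : Point n K) : CoordRing n K →ₐ[K] K :=
  MvPolynomial.aeval (Sym2.lift ⟨fun i j => M.1 i j, fun i j => M.2.apply j i⟩)

@[simp] theorem evalAt_X (M : Point n K) (i j : Fin n) :
    evalAt M (MvPolynomial.X s(i, j)) = M.1 i j := by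
  simp [evalAt]

/-- The action of automorphisms on points: the entries of `g • M` are the values at `M` of the
pull-backs under `g` of the coordinate functions. -/
noncomputable instance : SMul (Aut n K) (Point n K) where
  smul g M := ⟨Matrix.of fun i j => evalAt M (g.unop (MvPolynomial.X s(i, j))),
    Matrix.IsSymm.ext fun i j => by simp [Sym2.eq_swap]⟩

theorem point_smul_apply (g : Aut n K) (M : Point n K) (i j : Fin n) :
    (g • M).1 i j = evalAt M (g.unop (MvPolynomial.X s(i, j))) := rfl

/-- The value at `g • M` of a regular function is the value at `M` of its pull-back. -/
theorem evalAt_smul (g : Aut n K) (M : Point n K) (p : CoordRing n K) :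
    evalAt (g • M) p = evalAt M (g.unop p) := by
  have : evalAt (g • M) = (evalAt M).comp (g.unop : CoordRing n K →ₐ[K] CoordRing n K) := by
    ext s
    induction s with
    | h i j => simp [point_smul_apply]
  exact DFunLike.congr_fun this p

noncomputable instance : MulAction (Aut n K) (Point n K) where
  one_smul M := by
    ext i j
    simp [point_smul_apply]
  mul_smul g h M := by
    ext i j
    rw [point_smul_apply, point_smul_apply, evalAt_smul]
    rfl

variable (n K)

/-- The generic symmetric matrix `T = (T_ij)`. -/
noncomputable def generic : Matrix (Fin n) (Fin n) (CoordRing n K) :=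
  Matrix.of fun i j => MvPolynomial.X s(i, j)

variable {n}

/-- The matrix `E_ij T + T E_ijᵀ`, the derivative of `(1 + t E_ij) T (1 + t E_ij)ᵀ` at `t = 0`. -/
noncomputable def velocity (i j : Fin n) : Matrix (Fin n) (Fin n) (CoordRing n K) :=
  Matrix.single i j 1 * generic n K + generic n K * (Matrix.single i j 1).transpose

theorem velocity_apply (i j a b : Fin n) :
    velocity K i j a b =
      (if a = i then MvPolynomial.X s(j, b) else 0) +
      (if b = i then MvPolynomial.X s(a, j) else 0) := by
  simp [velocity, Matrix.mul_apply, Matrix.single_apply, generic, ite_and, @eq_comm _ i]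

theorem velocity_symm (i j a b : Fin n) : velocity K i j a b = velocity K i j b a := by
  rw [velocity_apply, velocity_apply, add_comm, Sym2.eq_swap, @Sym2.eq_swap _ j b]

/-- The infinitesimal generator of the action `B ↦ (1 + t E_ij) B (1 + t E_ij)ᵀ`
of the group `H_ij = 1 + K E_ij`, as a derivation of the coordinate ring: it maps each coordinate `T_ab` to
the corresponding entry of `E_ij T + T E_ijᵀ`. -/
noncomputable def delta (i j : Fin n) : Derivation K (CoordRing n K) (CoordRing n K) :=
  MvPolynomial.mkDerivation K (Sym2.lift ⟨fun a b => velocity K i j a b, velocity_symm K i j⟩)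

theorem delta_X (i j a b : Fin n) :
    delta K i j (MvPolynomial.X s(a, b)) =
      (if a = i then MvPolynomial.X s(j, b) else 0) +
      (if b = i then MvPolynomial.X s(a, j) else 0) := by
  simp [delta, velocity_apply]

theorem delta_isLocallyNilpotent {i j : Fin n} (hij : i ≠ j) :
    IsLocallyNilpotent (delta K i j) := by
  intro p
  induction p using MvPolynomial.induction_on with
  | C r => exact ⟨1, by simp⟩
  | add p q hp hq =>
    obtain ⟨N, hN⟩ := hp
    obtain ⟨N', hN'⟩ := hq
    exact ⟨max N N', by rw [iterate_map_add, iterate_eq_zero_of_le hN (le_max_left _ _),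
      iterate_eq_zero_of_le hN' (le_max_right _ _), add_zero]⟩
  | mul_X p s hp =>
    refine exists_iterate_mul_eq_zero hp ⟨3, ?_⟩
    induction s with
    | h a b =>
      have hji : j ≠ i := hij.symm
      by_cases ha : a = i <;> by_cases hb : b = i <;>
        simp [delta_X, ha, hb, hji]

/-- `G_sym`: the group of automorphisms generated by the one-parameter groups
`H_ij = {exp (t δ_ij) : t ∈ K}`, `i ≠ j`, and all their replicas
`{exp (t f δ_ij) : t ∈ K}`, `f ∈ ker δ_ij` (the choice `f = 1` gives `H_ij` itself). -/
noncomputable def Gsym (n : ℕ) (K : Type*) [Field K] [CharZero K] : Subgroup (Aut n K) :=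
  Subgroup.closure {g | ∃ (i j : Fin n) (hij : i ≠ j) (f : CoordRing n K)
    (hf : delta K i j f = 0) (t : K),
      g = MulOpposite.op (exp ((delta_isLocallyNilpotent K hij).replica hf) t)}

end Symmetric

end SymMat

/-! A replica `exp (t f δ_ij)` acts on a point `M` as the congruence by `1 + t f(M) E_ij`
(`exp_replica_smul`), so the transvection parameter may depend on the point. For `i ≠ p` the
coordinate `T_pp` lies in `ker δ_ij`, and so does every polynomial in it. If the matrices have
distinct `(p, p)` entries, Lagrange interpolation in `T_pp` gives an `f` that is `1` at one of them
and `0` at the others. Hence they can be moved independently by transvections with row index `≠ p`,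
which keep the `(p, p)` entries distinct (`exists_mem_Gsym_of_elemCongr`).

A common linear change of coordinates makes the `(0, 0)` entries distinct and nonzero in each tuple
(`exists_mem_Gsym_generic`). With these entries as labels, the `(1, 1)` entries of the first tuple
are made distinct and nonzero; with the latter as labels, its `(0, 0)` entries are changed to those
of the second tuple. Once the `(0, 0)` entries agree and are nonzero, splitting them off by Gaussian
elimination leaves symmetric matrices one size smaller with equal rank and determinant. Such
matrices are congruent by transvections over an algebraically closed field
(`elemCongr_of_rank_eq_of_det_eq`), so row index `0` is not needed for the last move. -/

namespace SymMat

/-! ### Congruence by transvections -/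

section ElementaryCongruence

open Matrix

variable {ι K : Type*} [Fintype ι] [DecidableEq ι] [Field K]

/-- The congruence `A ↦ (1 + t E_ij) A (1 + t E_ij)ᵀ`. -/
def transvectionCongr (i j : ι) (t : K) (A : Matrix ι ι K) : Matrix ι ι K :=
  transvection i j t * A * (transvection i j t)ᵀ

theorem transvectionCongr_apply (i j : ι) (t : K) (A : Matrix ι ι K) (a b : ι) :
    transvectionCongr i j t A a b =
      A a b + (if a = i then t * A j b else 0) + (if b = i then t * A a j else 0) +
        (if a = i ∧ b = i then t ^ 2 * A j j else 0) := by
  have h : ∀ c d, (transvection i j t * A) c d = A c d + if c = i then t * A j d else 0 := by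
    intro c d
    by_cases hc : c = i
    · subst hc; simp
    · simp [transvection_mul_apply_of_ne _ _ _ _ hc, hc]
  have h' : ∀ (B : Matrix ι ι K) c d, (B * (transvection i j t)ᵀ) c d =
      B c d + if d = i then t * B c j else 0 := by
    intro B c d
    rw [← transpose_transpose B, ← transpose_mul, transpose_apply]
    by_cases hc : d = i
    · subst hc; simp
    · simp [transvection_mul_apply_of_ne _ _ _ _ hc, hc]
  rw [transvectionCongr, h', h, h]
  by_cases ha : a = i <;> by_cases hb : b = i <;> simp [ha, hb]
  ring

theorem transvectionCongr_neg {i j : ι} (hij : i ≠ j) (t : K) (A : Matrix ι ι K) :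
    transvectionCongr i j (-t) (transvectionCongr i j t A) = A := by
  have h : transvection i j (-t) * transvection i j t = 1 := by
    rw [transvection_mul_transvection_same i j hij, neg_add_cancel, transvection_zero]
  calc _ = (transvection i j (-t) * transvection i j t) * A *
        (transvection i j (-t) * transvection i j t)ᵀ := by
          simp only [transvectionCongr, transpose_mul, Matrix.mul_assoc]
    _ = A := by simp [h]

theorem isSymm_transvectionCongr {A : Matrix ι ι K} (hA : A.IsSymm) (i j : ι) (t : K) :
    (transvectionCongr i j t A).IsSymm := by
  rw [IsSymm, transvectionCongr, transpose_mul, transpose_mul, transpose_transpose, hA.eq,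
    Matrix.mul_assoc]

theorem det_transvectionCongr {i j : ι} (hij : i ≠ j) (t : K) (A : Matrix ι ι K) :
    (transvectionCongr i j t A).det = A.det := by
  simp [transvectionCongr, det_transvection_of_ne _ _ hij]

theorem rank_transvectionCongr {i j : ι} (hij : i ≠ j) (t : K) (A : Matrix ι ι K) :
    (transvectionCongr i j t A).rank = A.rank := by
  have h : IsUnit (transvection i j t).det := by simp [det_transvection_of_ne _ _ hij]
  rw [transvectionCongr, rank_mul_eq_left_of_isUnit_det _ _ (by rwa [det_transpose]),
    rank_mul_eq_right_of_isUnit_det _ _ h]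

/-- `ElemCongr P A B`: the matrix `B` is obtained from `A` by a sequence of congruences by
`1 + t E_ij` whose row index `i` satisfies `P`. -/
def ElemCongr (P : ι → Prop) : Matrix ι ι K → Matrix ι ι K → Prop :=
  Relation.ReflTransGen fun A B => ∃ i j, i ≠ j ∧ P i ∧ ∃ t, B = transvectionCongr i j t A

namespace ElemCongr

variable {P : ι → Prop} {A B C : Matrix ι ι K}

theorem single {i j : ι} (hij : i ≠ j) (hi : P i) (t : K) (A : Matrix ι ι K) :
    ElemCongr P A (transvectionCongr i j t A) :=
  Relation.ReflTransGen.single ⟨i, j, hij, hi, t, rfl⟩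

theorem trans (h : ElemCongr P A B) (h' : ElemCongr P B C) : ElemCongr P A C :=
  Relation.ReflTransGen.trans h h'

theorem symm (h : ElemCongr P A B) : ElemCongr P B A := by
  induction h with
  | refl => exact Relation.ReflTransGen.refl
  | tail _ h ih =>
    obtain ⟨i, j, hij, hi, t, rfl⟩ := h
    exact .head ⟨i, j, hij, hi, -t, (transvectionCongr_neg hij t _).symm⟩ ih

theorem mono {Q : ι → Prop} (hPQ : ∀ i, P i → Q i) (h : ElemCongr P A B) : ElemCongr Q A B :=
  Relation.ReflTransGen.mono
    (fun _ _ ⟨i, j, hij, hi, t, ht⟩ => ⟨i, j, hij, hPQ i hi, t, ht⟩) _ _ h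

theorem det_eq (h : ElemCongr P A B) : B.det = A.det := by
  induction h with
  | refl => rfl
  | tail _ h ih =>
    obtain ⟨i, j, hij, _, t, rfl⟩ := h
    rw [det_transvectionCongr hij, ih]

theorem rank_eq (h : ElemCongr P A B) : B.rank = A.rank := by
  induction h with
  | refl => rfl
  | tail _ h ih =>
    obtain ⟨i, j, hij, _, t, rfl⟩ := h
    rw [rank_transvectionCongr hij, ih]

theorem isSymm (h : ElemCongr P A B) (hA : A.IsSymm) : B.IsSymm := by
  induction h with
  | refl => exact hA
  | tail _ h ih =>
    obtain ⟨i, j, _, _, t, rfl⟩ := h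
    exact isSymm_transvectionCongr ih i j t

/-- Transvections with row index `≠ p` do not change the entry at `(p, p)`. -/
theorem apply_self {p : ι} (h : ElemCongr (· ≠ p) A B) : B p p = A p p := by
  induction h with
  | refl => rfl
  | tail _ h ih =>
    obtain ⟨i, j, _, hi, t, rfl⟩ := h
    rw [transvectionCongr_apply, ih]
    simp [hi.symm]

end ElemCongr

/-- If `A j j ≠ 0` then the entry at `(i, i)` can be given any value. -/
theorem exists_transvectionCongr_apply_self_eq [IsAlgClosed K] [CharZero K] {A : Matrix ι ι K}
    (hA : A.IsSymm) {i j : ι} (hj : A j j ≠ 0) (α : K) :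
    ∃ t, transvectionCongr i j t A i i = α := by
  -- The new entry is `A i i + 2 t A i j + t² A j j`, a quadratic polynomial in `t` with leading
  -- coefficient `A j j ≠ 0`.
  obtain ⟨s, hs⟩ := IsAlgClosed.exists_eq_mul_self
    (discrim (A j j) (2 * A i j) (A i i - α))
  obtain ⟨t, ht⟩ := exists_quadratic_eq_zero hj ⟨s, hs⟩
  refine ⟨t, ?_⟩
  rw [transvectionCongr_apply, hA.apply i j]
  simp
  linear_combination ht

/-! ### Splitting off a pivot -/

/-- The block diagonal matrix with blocks `c` and `N`. -/
def bordered {m : ℕ} (c : K) (N : Matrix (Fin m) (Fin m) K) :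
    Matrix (Fin (m + 1)) (Fin (m + 1)) K :=
  of (Fin.cons (Fin.cons c 0) fun i => Fin.cons 0 (N i))

section bordered

variable {m : ℕ} (c : K) (N : Matrix (Fin m) (Fin m) K)

@[simp] theorem bordered_zero_zero : bordered c N 0 0 = c := rfl
@[simp] theorem bordered_zero_succ (j : Fin m) : bordered c N 0 j.succ = 0 := rfl
@[simp] theorem bordered_succ_zero (i : Fin m) : bordered c N i.succ 0 = 0 := rfl
@[simp] theorem bordered_succ_succ (i j : Fin m) : bordered c N i.succ j.succ = N i j := rfl

theorem det_bordered : (bordered c N).det = c * N.det := by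
  rw [det_succ_row_zero, Fin.sum_univ_succ]
  have : (bordered c N).submatrix Fin.succ Fin.succ = N := by ext; simp
  simp [this]

theorem bordered_mulVec_cons (x : K) (v : Fin m → K) :
    bordered c N *ᵥ (Fin.cons x v : Fin (m + 1) → K) = Fin.cons (c * x) (N *ᵥ v) := by
  ext i
  refine Fin.cases ?_ (fun i => ?_) i <;> simp [mulVec, dotProduct, Fin.sum_univ_succ]

/-- Since `c ≠ 0`, the map `v ↦ (0, v)` identifies the two kernels; rank–nullity does the rest. -/
theorem rank_bordered {c : K} (hc : c ≠ 0) : (bordered c N).rank = N.rank + 1 := by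
  let f : (N.mulVecLin).ker →ₗ[K] (bordered c N).mulVecLin.ker :=
    { toFun := fun v => ⟨Fin.cons 0 v.1, by
        have := v.2
        simp only [LinearMap.mem_ker, mulVecLin_apply] at this ⊢
        rw [bordered_mulVec_cons, this]
        ext i; refine Fin.cases ?_ (fun i => ?_) i <;> simp⟩
      map_add' := fun v w => by
        ext i; refine Fin.cases ?_ (fun i => ?_) i <;> simp
      map_smul' := fun a v => by
        ext i; refine Fin.cases ?_ (fun i => ?_) i <;> simp }
  have hf : Function.Bijective f := by
    constructor
    · intro v w h
      ext i
      simpa [f] using congrFun (congrArg Subtype.val h) i.succ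
    · rintro ⟨v, hv⟩
      obtain ⟨x, w, rfl⟩ : ∃ x w, v = (Fin.cons x w : Fin (m + 1) → K) :=
        ⟨v 0, Fin.tail v, (Fin.cons_self_tail v).symm⟩
      simp only [LinearMap.mem_ker, mulVecLin_apply, bordered_mulVec_cons] at hv
      have hx : x = 0 := by simpa [hc] using congrFun hv 0
      have hw : N *ᵥ w = 0 := by
        ext i; simpa using congrFun hv i.succ
      exact ⟨⟨w, by simpa using hw⟩, by ext i; simp [f, hx]⟩
  have h1 := (LinearEquiv.ofBijective f hf).finrank_eq
  have h2 := N.mulVecLin.finrank_range_add_finrank_ker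
  have h3 := (bordered c N).mulVecLin.finrank_range_add_finrank_ker
  simp only [Module.finrank_fintype_fun_eq_card, Fintype.card_fin] at h2 h3
  rw [rank, rank]
  omega

theorem transvectionCongr_bordered (i j : Fin m) (t : K) :
    transvectionCongr i.succ j.succ t (bordered c N) = bordered c (transvectionCongr i j t N) := by
  ext a b
  rw [transvectionCongr_apply]
  refine Fin.cases ?_ (fun a => ?_) a <;> refine Fin.cases ?_ (fun b => ?_) b <;>
    simp [transvectionCongr_apply, (Fin.succ_ne_zero _).symm]

theorem ElemCongr.bordered {P : Fin m → Prop} {N N' : Matrix (Fin m) (Fin m) K}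
    (h : ElemCongr P N N') : ElemCongr (· ≠ 0) (bordered c N) (bordered c N') := by
  induction h with
  | refl => exact Relation.ReflTransGen.refl
  | tail _ h ih =>
    obtain ⟨i, j, hij, _, t, rfl⟩ := h
    rw [← transvectionCongr_bordered]
    exact ih.trans (single (P := (· ≠ 0)) (i := i.succ) (j := j.succ) (by simpa using hij)
      (Fin.succ_ne_zero i) t _)

/-- Gaussian elimination with the pivot at `(0, 0)`. -/
theorem exists_elemCongr_bordered {A : Matrix (Fin (m + 1)) (Fin (m + 1)) K} (hA : A.IsSymm)
    (h0 : A 0 0 ≠ 0) :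
    ∃ N : Matrix (Fin m) (Fin m) K, N.IsSymm ∧ ElemCongr (· ≠ 0) A (SymMat.bordered (A 0 0) N) := by
  have key : ∀ s : Finset (Fin m), ∃ B, ElemCongr (· ≠ 0) A B ∧ ∀ j ∈ s, B j.succ 0 = 0 := by
    intro s
    induction s using Finset.induction_on with
    | empty => exact ⟨A, Relation.ReflTransGen.refl, by simp⟩
    | insert j s hj ih =>
      obtain ⟨B, hB, hs⟩ := ih
      -- The parameter clears the entry at `(j.succ, 0)`. The pivot is still `A 0 0`, because every
      -- row index used is nonzero, and the other entries of column `0` do not change.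
      refine ⟨_, hB.trans (.single (Fin.succ_ne_zero j) (Fin.succ_ne_zero j)
        (-(B j.succ 0) / A 0 0) _), fun i hi => ?_⟩
      have hj0 : (0 : Fin (m + 1)) ≠ j.succ := (Fin.succ_ne_zero j).symm
      rw [transvectionCongr_apply]
      simp only [hj0, if_false, and_false, add_zero, Fin.succ_inj, hB.apply_self]
      split_ifs with hij
      · subst hij; field_simp; ring
      · rw [hs i ((Finset.mem_insert.1 hi).resolve_left hij), add_zero]
  obtain ⟨B, hB, h⟩ := key Finset.univ
  have hBs := hB.isSymm hA
  have hBe : B = SymMat.bordered (A 0 0) (B.submatrix Fin.succ Fin.succ) := by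
    ext a b
    refine Fin.cases ?_ (fun a => ?_) a <;> refine Fin.cases ?_ (fun b => ?_) b
    · exact hB.apply_self
    · rw [← hBs.apply]; simp [h]
    · simp [h]
    · simp
  exact ⟨_, hBs.submatrix _, hBe ▸ hB⟩

end bordered

/-! ### Classification by rank and determinant -/

theorem eq_zero_of_rank_eq_zero {A : Matrix ι ι K} (h : A.rank = 0) : A = 0 := by
  have h : A.mulVecLin = 0 := by
    rw [← LinearMap.range_eq_bot]
    exact Submodule.finrank_eq_zero.1 h
  ext i j
  simpa using congrFun (LinearMap.congr_fun h (Pi.single j 1)) i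

/-- A nonzero symmetric matrix of size at least two can be given the entry `1` at `(0, 0)`. -/
theorem exists_elemCongr_zero_zero_eq_one [IsAlgClosed K] [CharZero K] {m : ℕ}
    {A : Matrix (Fin (m + 2)) (Fin (m + 2)) K} (hA : A.IsSymm) (hA0 : A ≠ 0) :
    ∃ B, ElemCongr (fun _ => True) A B ∧ B 0 0 = 1 := by
  -- A nonzero diagonal entry away from `0` suffices: a transvection with row index `0` then solves
  -- a quadratic equation for the `(0, 0)` entry.
  have pivot : ∃ B, ElemCongr (fun _ => True) A B ∧ ∃ j, j ≠ 0 ∧ B j j ≠ 0 := by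
    by_cases h : ∃ j, j ≠ 0 ∧ A j j ≠ 0
    · exact ⟨A, Relation.ReflTransGen.refl, h⟩
    push Not at h
    by_cases h0 : ∃ i j, i ≠ j ∧ i ≠ 0 ∧ A i j ≠ 0
    · obtain ⟨i, j, hij, hi, hne⟩ := h0
      have hval : ∀ t, transvectionCongr i j t A i i = t * (2 * A i j + t * A j j) := by
        intro t
        rw [transvectionCongr_apply, hA.apply i j, h i hi]
        simp
        ring
      -- If `t = 1` fails, then `A j j = -2 * A i j`, and `t = -1` gives `-4 * A i j ≠ 0`.
      by_cases h1 : 2 * A i j + A j j = 0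
      · refine ⟨_, .single hij trivial (-1) A, i, hi, ?_⟩
        rw [hval]
        intro h2
        exact hne (by linear_combination (h1 - h2) / 4)
      · refine ⟨_, .single hij trivial 1 A, i, hi, ?_⟩
        rw [hval]
        simpa using h1
    · push Not at h0
      -- Only the `(0, 0)` entry is left to be nonzero; a transvection copies it to `(1, 1)`.
      have h00 : A 0 0 ≠ 0 := by
        intro h00
        apply hA0
        ext a b
        by_cases ha : a = 0
        · by_cases hb : b = 0
          · rw [ha, hb, h00]; rfl
          · rw [ha, ← hA.apply, h0 b 0 hb hb]; rfl
        · by_cases hab : a = b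
          · rw [← hab, h a ha]; rfl
          · rw [h0 a b hab ha]; rfl
      have h10 : (1 : Fin (m + 2)) ≠ 0 := by simp
      refine ⟨_, .single h10 trivial 1 A, 1, h10, ?_⟩
      rw [transvectionCongr_apply, h 1 h10, h0 1 0 h10 h10, ← hA.apply, h0 1 0 h10 h10]
      simpa using h00
  obtain ⟨B, hB, j, hj, hne⟩ := pivot
  obtain ⟨t, ht⟩ := exists_transvectionCongr_apply_self_eq (hB.isSymm hA) (i := 0) hne 1
  exact ⟨_, hB.trans (.single hj.symm trivial t B), ht⟩

/-- Symmetric matrices of equal rank and determinant are congruent under `SL_n`. -/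
theorem elemCongr_of_rank_eq_of_det_eq [IsAlgClosed K] [CharZero K] : ∀ {m : ℕ}
    {A B : Matrix (Fin m) (Fin m) K}, A.IsSymm → B.IsSymm → A.rank = B.rank → A.det = B.det →
    ElemCongr (fun _ => True) A B
  | 0, A, B, _, _, _, _ => by
    rw [Subsingleton.elim A B]; exact Relation.ReflTransGen.refl
  -- In size one there are no transvections, but the determinant is the entry itself.
  | 1, A, B, _, _, _, hd => by
    have : A = B := by
      ext i j
      rw [Subsingleton.elim i 0, Subsingleton.elim j 0]
      simpa using hd
    rw [this]; exact Relation.ReflTransGen.refl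
  | m + 2, A, B, hA, hB, hr, hd => by
    by_cases hA0 : A = 0
    · rw [hA0, rank_zero] at hr
      rw [hA0, eq_zero_of_rank_eq_zero hr.symm]
      exact Relation.ReflTransGen.refl
    have hB0 : B ≠ 0 := by
      rintro rfl
      exact hA0 (eq_zero_of_rank_eq_zero (hr.trans rank_zero))
    obtain ⟨A₁, hA₁, hA1⟩ := exists_elemCongr_zero_zero_eq_one hA hA0
    obtain ⟨B₁, hB₁, hB1⟩ := exists_elemCongr_zero_zero_eq_one hB hB0
    obtain ⟨N, hN, hAN⟩ := exists_elemCongr_bordered (hA₁.isSymm hA) (by simp [hA1])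
    obtain ⟨N', hN', hBN⟩ := exists_elemCongr_bordered (hB₁.isSymm hB) (by simp [hB1])
    rw [hA1] at hAN
    rw [hB1] at hBN
    have hA₂ := hA₁.trans (hAN.mono fun _ _ => trivial)
    have hB₂ := hB₁.trans (hBN.mono fun _ _ => trivial)
    -- Both matrices now have the form `1 ⊕ N`. Removing the block `1` lowers both ranks by one and
    -- keeps the determinants, so induction applies.
    have h := elemCongr_of_rank_eq_of_det_eq hN hN'
      (by
        have := hA₂.rank_eq.trans (hr.trans hB₂.rank_eq.symm)
        simpa [rank_bordered] using this)
      (by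
        have := hA₂.det_eq.trans (hd.trans hB₂.det_eq.symm)
        simpa [det_bordered] using this)
    exact (hA₂.trans ((h.bordered 1).mono fun _ _ => trivial)).trans hB₂.symm

/-- Symmetric matrices of equal rank and determinant with the same nonzero entry at `(0, 0)` are
congruent under the group generated by the transvections with row index `≠ 0`. -/
theorem elemCongr_of_zero_zero_eq [IsAlgClosed K] [CharZero K] {m : ℕ}
    {A B : Matrix (Fin (m + 1)) (Fin (m + 1)) K} (hA : A.IsSymm) (hB : B.IsSymm)
    (hr : A.rank = B.rank) (hd : A.det = B.det) (h : A 0 0 = B 0 0) (h0 : B 0 0 ≠ 0) :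
    ElemCongr (· ≠ 0) A B := by
  obtain ⟨N, hN, hAN⟩ := exists_elemCongr_bordered hA (h ▸ h0)
  obtain ⟨N', hN', hBN⟩ := exists_elemCongr_bordered hB h0
  rw [h] at hAN
  refine (hAN.trans (ElemCongr.bordered _ (elemCongr_of_rank_eq_of_det_eq hN hN' ?_ ?_))).trans
    hBN.symm
  · have := hAN.rank_eq.trans (hr.trans hBN.rank_eq.symm)
    simpa [rank_bordered _ h0] using this
  · have := hAN.det_eq.trans (hd.trans hBN.det_eq.symm)
    simpa [det_bordered, h0] using this

end ElementaryCongruence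

/-! ### Replicas and independent moves -/

section CollectiveMoves

open Matrix

variable {n : ℕ} {K : Type*} [Field K]

theorem iterate_smul_derivation {A : Type*} [CommRing A] [Algebra K A] {D : Derivation K A A}
    {f : A} (hf : D f = 0) (m : ℕ) (a : A) : (f • D)^[m] a = f ^ m * D^[m] a := by
  induction m with
  | zero => simp
  | succ m ih =>
    have h0 : D (f ^ m) = 0 := by rw [Derivation.leibniz_pow, hf]; simp
    rw [Function.iterate_succ_apply', ih, Function.iterate_succ_apply',
      Derivation.smul_apply, Derivation.leibniz, h0]
    simp only [smul_eq_mul, mul_zero, add_zero]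
    ring

theorem delta_delta_X {i j : Fin n} (hij : i ≠ j) (a b : Fin n) :
    delta K i j (delta K i j (MvPolynomial.X s(a, b))) =
      if a = i ∧ b = i then MvPolynomial.X s(j, j) + MvPolynomial.X s(j, j) else 0 := by
  by_cases ha : a = i <;> by_cases hb : b = i <;> simp [delta_X, ha, hb, hij.symm]

variable [CharZero K]

/-- The replica `exp (t f δ_ij)` acts on a symmetric matrix `M` as `1 + t f(M) E_ij` does. -/
theorem exp_replica_smul {i j : Fin n} (hij : i ≠ j) {f : CoordRing n K} (hf : delta K i j f = 0)
    (t : K) (M : Point n K) :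
    ((MulOpposite.op (exp ((delta_isLocallyNilpotent K hij).replica hf) t) : Aut n K) • M).1 =
      transvectionCongr i j (t * evalAt M f) M.1 := by
  ext a b
  -- The exponential stops at the quadratic term. That term survives only on `T_ii`, where `(t f)² /
  -- 2` times `2 T_jj` is the `t²` term of the congruence.
  have h3 : (f • delta K i j)^[3] (MvPolynomial.X s(a, b)) = 0 := by
    rw [iterate_smul_derivation hf, Function.iterate_succ_apply', Function.iterate_succ_apply',
      Function.iterate_one, delta_delta_X hij]
    split_ifs <;> simp [delta_X, hij.symm]
  rw [point_smul_apply, MulOpposite.unop_op]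
  change evalAt M (expFun _ t _) = _
  rw [expFun_eq_sum _ t _ h3, Finset.sum_range_succ, Finset.sum_range_succ, Finset.sum_range_one,
    iterate_smul_derivation hf, iterate_smul_derivation hf, iterate_smul_derivation hf,
    transvectionCongr_apply]
  simp only [Function.iterate_succ_apply', Function.iterate_zero_apply, delta_delta_X hij]
  rw [delta_X]
  by_cases ha : a = i <;> by_cases hb : b = i <;> simp [ha, hb] <;> ring

theorem exp_replica_mem_Gsym {i j : Fin n} (hij : i ≠ j) {f : CoordRing n K}
    (hf : delta K i j f = 0) (t : K) :
    (MulOpposite.op (exp ((delta_isLocallyNilpotent K hij).replica hf) t) : Aut n K) ∈ Gsym n K :=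
  Subgroup.subset_closure ⟨i, j, hij, f, hf, t, rfl⟩

theorem exists_mem_Gsym_transvectionCongr {i j : Fin n} (hij : i ≠ j) (t : K) :
    ∃ g ∈ Gsym n K, ∀ M : Point n K, (g • M).1 = transvectionCongr i j t M.1 :=
  ⟨_, exp_replica_mem_Gsym hij (Derivation.map_one_eq_zero _) t, fun M => by
    rw [exp_replica_smul hij (Derivation.map_one_eq_zero _), map_one, mul_one]⟩

variable {k : ℕ} {p : Fin n}

/-- If the entries at `(p, p)` are pairwise distinct, then an elementary congruence with row index
`≠ p` can be applied to one of the matrices while all others are fixed. -/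
theorem exists_mem_Gsym_move_one {M : Fin k → Point n K}
    (hM : Function.Injective fun l => (M l).1 p p) (l : Fin k) {i j : Fin n} (hij : i ≠ j)
    (hi : i ≠ p) (t : K) :
    ∃ g ∈ Gsym n K, (g • M l).1 = transvectionCongr i j t (M l).1 ∧
      ∀ l', l' ≠ l → g • M l' = M l' := by
  -- The polynomial `q` in `T_pp` is `1` at `M l` and `0` at the other points; it is killed by
  -- `δ_ij` because `i ≠ p`.
  let q : Polynomial K := Lagrange.basis Finset.univ (fun l => (M l).1 p p) l
  let f : CoordRing n K := Polynomial.aeval (MvPolynomial.X s(p, p)) q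
  have hf : delta K i j f = 0 := by
    rw [Derivation.map_aeval, delta_X]
    simp [hi.symm]
  have hev : ∀ l', evalAt (M l') f = q.eval ((M l').1 p p) := by
    intro l'
    rw [← Polynomial.aeval_algHom_apply, evalAt_X, Polynomial.coe_aeval_eq_eval]
  refine ⟨_, exp_replica_mem_Gsym hij hf t, ?_, fun l' hl' => Subtype.ext ?_⟩
  · rw [exp_replica_smul hij hf, hev, Lagrange.eval_basis_self hM.injOn (Finset.mem_univ l), mul_one]
  · have h0 : q.eval ((M l').1 p p) = 0 :=
      Lagrange.eval_basis_of_ne (v := fun l => (M l).1 p p) hl'.symm (Finset.mem_univ l')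
    rw [exp_replica_smul hij hf, hev, h0, mul_zero]
    simp [transvectionCongr]

/-- The `(p, p)` entries are unchanged by each elementary step, so they stay distinct and the single
move can be iterated. -/
theorem exists_mem_Gsym_move_one_of_elemCongr {M : Fin k → Point n K}
    (hM : Function.Injective fun l => (M l).1 p p) (l : Fin k) {B : Matrix (Fin n) (Fin n) K}
    (h : ElemCongr (· ≠ p) (M l).1 B) :
    ∃ g ∈ Gsym n K, (g • M l).1 = B ∧ ∀ l', l' ≠ l → g • M l' = M l' := by
  induction h with
  | refl => exact ⟨1, one_mem _, by simp, by simp⟩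
  | @tail B C hB h ih =>
    obtain ⟨g, hg, hgl, hg'⟩ := ih
    obtain ⟨i, j, hij, hi, t, rfl⟩ := h
    have hpp : (fun l' => (g • M l').1 p p) = fun l' => (M l').1 p p := by
      ext l'
      by_cases hl : l' = l
      · rw [hl, hgl]; exact ElemCongr.apply_self hB
      · rw [hg' l' hl]
    obtain ⟨g', hgm, h1, h2⟩ := exists_mem_Gsym_move_one (M := fun l' => g • M l')
      (hpp ▸ hM) l hij hi t
    refine ⟨g' * g, mul_mem hgm hg, by rw [mul_smul, h1, hgl], fun l' hl' => ?_⟩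
    rw [mul_smul, h2 l' hl', hg' l' hl']

/-- If the entries at `(p, p)` are pairwise distinct, then the matrices can be moved independently
of each other by elementary congruences with row index `≠ p`. -/
theorem exists_mem_Gsym_of_elemCongr {M M' : Fin k → Point n K}
    (hM : Function.Injective fun l => (M l).1 p p)
    (h : ∀ l, ElemCongr (· ≠ p) (M l).1 (M' l).1) :
    ∃ g ∈ Gsym n K, ∀ l, g • M l = M' l := by
  have key : ∀ s : Finset (Fin k), ∃ g ∈ Gsym n K, (∀ l ∈ s, g • M l = M' l) ∧
      ∀ l ∉ s, g • M l = M l := by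
    intro s
    induction s using Finset.induction_on with
    | empty => exact ⟨1, one_mem _, by simp, by simp⟩
    | insert l s hl ih =>
      obtain ⟨g, hg, h1, h2⟩ := ih
      have hpp : (fun l' => (g • M l').1 p p) = fun l' => (M l').1 p p := by
        ext l'
        by_cases hl' : l' ∈ s
        · rw [h1 l' hl']; exact (h l').apply_self
        · rw [h2 l' hl']
      obtain ⟨g', hgm, h3, h4⟩ := exists_mem_Gsym_move_one_of_elemCongr
        (M := fun l' => g • M l') (hpp ▸ hM) l (B := (M' l).1) (by rw [h2 l hl]; exact h l)
      refine ⟨g' * g, mul_mem hgm hg, fun l' hl' => ?_, fun l' hl' => ?_⟩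
      · rw [mul_smul]
        rcases Finset.mem_insert.1 hl' with rfl | hl'
        · exact Subtype.ext h3
        · rw [h4 l' (ne_of_mem_of_not_mem hl' hl), h1 l' hl']
      · rw [Finset.mem_insert, not_or] at hl'
        rw [mul_smul, h4 l' hl'.1, h2 l' hl'.2]
  obtain ⟨g, hg, h1, _⟩ := key Finset.univ
  exact ⟨g, hg, fun l => h1 l (Finset.mem_univ l)⟩

end CollectiveMoves

/-! ### General position -/

section GeneralPosition

open Matrix

variable {n : ℕ} {K : Type*} [Field K]

/-- The quadratic form of the symmetric matrix `A`, as a polynomial. -/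
noncomputable def quadPoly (A : Matrix (Fin n) (Fin n) K) : MvPolynomial (Fin n) K :=
  ∑ i, ∑ j, MvPolynomial.C (A i j) * MvPolynomial.X i * MvPolynomial.X j

theorem eval_quadPoly (A : Matrix (Fin n) (Fin n) K) (v : Fin n → K) :
    MvPolynomial.eval v (quadPoly A) = v ⬝ᵥ A *ᵥ v := by
  simp only [quadPoly, map_sum, map_mul, MvPolynomial.eval_C, MvPolynomial.eval_X, dotProduct,
    mulVec, Finset.mul_sum]
  refine Finset.sum_congr rfl fun i _ => Finset.sum_congr rfl fun j _ => by ring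

variable [CharZero K]

/-- Polarization: values at basis vectors give the diagonal entries, values at sums of two give `2 *
A i j`, and `2` is invertible. -/
theorem quadPoly_ne_zero {A : Matrix (Fin n) (Fin n) K} (hA : A.IsSymm) (hA0 : A ≠ 0) :
    quadPoly A ≠ 0 := by
  intro h
  have hv : ∀ v, v ⬝ᵥ A *ᵥ v = 0 := fun v => by rw [← eval_quadPoly, h, map_zero]
  have hd : ∀ i, A i i = 0 := fun i => by simpa using hv (Pi.single i 1)
  apply hA0
  ext i j
  have := hv (Pi.single i 1 + Pi.single j 1)
  simp [mulVec_add, hd, hA.apply i j] at this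
  simpa using this

/-- Some linear change of coordinates gives the matrix `A` the `(0, 0)` entry `uᵀ A u`. -/
theorem exists_mem_Gsym_zero_zero_eq {m : ℕ} (u : Fin (m + 1) → K) (hu : u 0 = 1) :
    ∃ g ∈ Gsym (m + 1) K, ∀ M : Point (m + 1) K, (g • M).1 0 0 = u ⬝ᵥ M.1 *ᵥ u := by
  have key : ∀ s : Finset (Fin m), ∃ g ∈ Gsym (m + 1) K, ∀ M : Point (m + 1) K,
      (g • M).1 0 0 = (Fin.cons 1 fun j => if j ∈ s then u j.succ else 0 : Fin (m + 1) → K) ⬝ᵥ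
        M.1 *ᵥ (Fin.cons 1 fun j => if j ∈ s then u j.succ else 0) := by
    intro s
    induction s using Finset.induction_on with
    | empty =>
      refine ⟨1, one_mem _, fun M => ?_⟩
      simp [dotProduct, mulVec, Fin.sum_univ_succ]
    | insert j s hj ih =>
      obtain ⟨g, hg, h⟩ := ih
      obtain ⟨g', hgm, h'⟩ :=
        exists_mem_Gsym_transvectionCongr (Fin.succ_ne_zero j).symm (u j.succ)
      -- Here `g'` acts first: `vᵀ (T M Tᵀ) v` is the form of `M` at `Tᵀ v`, and since `v 0 = 1`,
      -- `Tᵀ` fills in the coordinate `u j.succ`.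
      refine ⟨g * g', mul_mem hg hgm, fun M => ?_⟩
      set v : Fin (m + 1) → K := Fin.cons 1 fun i => if i ∈ s then u i.succ else 0 with hv
      have hT : (transvection 0 j.succ (u j.succ))ᵀ *ᵥ v =
          Fin.cons 1 fun i => if i ∈ insert j s then u i.succ else 0 := by
        rw [transvection, transpose_add, transpose_one, transpose_single, add_mulVec, one_mulVec,
          single_mulVec]
        ext i
        refine Fin.cases ?_ (fun i => ?_) i
        · simp [hv, (Fin.succ_ne_zero j).symm]
        · by_cases hij : i = j
          · subst hij; simp [hv, hj]
          · simp [hv, hij]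
      rw [mul_smul, h, h', transvectionCongr, ← hT, ← mulVec_mulVec, ← mulVec_mulVec,
        dotProduct_mulVec, ← mulVec_transpose]
  obtain ⟨g, hg, h⟩ := key Finset.univ
  refine ⟨g, hg, fun M => ?_⟩
  have : (Fin.cons 1 fun j => if j ∈ Finset.univ then u j.succ else 0 : Fin (m + 1) → K) = u := by
    ext i
    refine Fin.cases ?_ (fun i => ?_) i <;> simp [hu]
  rw [h, this]

/-- Distinct nonzero symmetric matrices can be moved simultaneously to matrices with distinct
nonzero entries at `(0, 0)`. -/
theorem exists_mem_Gsym_generic {m k : ℕ} {M : Fin k → Point (m + 1) K}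
    (hM : Function.Injective M) (h0 : ∀ l, (M l).1 ≠ 0) :
    ∃ g ∈ Gsym (m + 1) K, (Function.Injective fun l => (g • M l).1 0 0) ∧
      ∀ l, (g • M l).1 0 0 ≠ 0 := by
  -- At a point where `F` does not vanish, the forms are nonzero and pairwise distinct. The factor
  -- `X 0` allows rescaling to first coordinate `1`, which multiplies all values by the same nonzero
  -- scalar.
  let F : MvPolynomial (Fin (m + 1)) K := MvPolynomial.X 0 * ((∏ l, quadPoly (M l).1) *
    ∏ l, ∏ l', if l = l' then 1 else quadPoly ((M l).1 - (M l').1))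
  have hF : F ≠ 0 := by
    refine mul_ne_zero (MvPolynomial.X_ne_zero 0) (mul_ne_zero
      (Finset.prod_ne_zero_iff.2 fun l _ => quadPoly_ne_zero (M l).2 (h0 l))
      (Finset.prod_ne_zero_iff.2 fun l _ => Finset.prod_ne_zero_iff.2 fun l' _ => ?_))
    split_ifs with h
    · exact one_ne_zero
    · exact quadPoly_ne_zero ((M l).2.sub (M l').2)
        (sub_ne_zero.2 fun e => h (hM (Subtype.ext e)))
  obtain ⟨v, hv⟩ : ∃ v, MvPolynomial.eval v F ≠ 0 := by
    by_contra! h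
    exact hF (MvPolynomial.funext fun v => by rw [h, map_zero])
  simp only [F, map_mul, map_prod, mul_ne_zero_iff, Finset.prod_ne_zero_iff, MvPolynomial.eval_X,
    eval_quadPoly, Finset.mem_univ, true_imp_iff] at hv
  obtain ⟨hv0, hv1, hv2⟩ := hv
  obtain ⟨g, hg, h⟩ := exists_mem_Gsym_zero_zero_eq ((v 0)⁻¹ • v) (by simp [hv0])
  have hval : ∀ l, (g • M l).1 0 0 = (v 0)⁻¹ * ((v 0)⁻¹ * (v ⬝ᵥ (M l).1 *ᵥ v)) := fun l => by
    rw [h, mulVec_smul, smul_dotProduct, dotProduct_smul]; rfl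
  have hi := inv_ne_zero hv0
  refine ⟨g, hg, fun l l' e => ?_, fun l => ?_⟩
  · by_contra hne
    have h2 := hv2 l l'
    rw [if_neg hne, eval_quadPoly, sub_mulVec, dotProduct_sub] at h2
    simp only [hval] at e
    exact h2 (sub_eq_zero.2 (mul_left_cancel₀ hi (mul_left_cancel₀ hi e)))
  · rw [hval]
    exact mul_ne_zero hi (mul_ne_zero hi (hv1 l))

end GeneralPosition

/-! ### Combining the moves -/

/-- Tuples with distinct nonzero entries at `(0, 0)` and equal ranks and determinants are in the same
orbit. -/
theorem exists_mem_Gsym_of_injective_zero_zero {K : Type*} [Field K] [IsAlgClosed K]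
    [CharZero K] {m k : ℕ} {M M' : Fin k → Point (m + 2) K}
    (hM : Function.Injective fun l => (M l).1 0 0) (hM0 : ∀ l, (M l).1 0 0 ≠ 0)
    (hM' : Function.Injective fun l => (M' l).1 0 0) (hM0' : ∀ l, (M' l).1 0 0 ≠ 0)
    (hrank : ∀ l, (M l).1.rank = (M' l).1.rank) (hdet : ∀ l, (M l).1.det = (M' l).1.det) :
    ∃ g ∈ Gsym (m + 2) K, ∀ l, g • M l = M' l := by
  have h10 : (1 : Fin (m + 2)) ≠ 0 := by simp
  -- The targets `l + 1` are distinct and nonzero in characteristic zero; they serve as labels while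
  -- the `(0, 0)` entries are changed.
  choose t ht using fun l => exists_transvectionCongr_apply_self_eq (M l).2 (i := 1) (hM0 l)
    ((l : ℕ) + 1 : K)
  let N : Fin k → Point (m + 2) K := fun l => ⟨_, isSymm_transvectionCongr (M l).2 1 0 (t l)⟩
  have hMN : ∀ l, ElemCongr (· ≠ 0) (M l).1 (N l).1 := fun l => .single h10 h10 (t l) _
  have hN : ∀ l, (N l).1 1 1 = (l : ℕ) + 1 := ht
  have hN0 : ∀ l, (N l).1 1 1 ≠ 0 := fun l => by rw [hN]; exact Nat.cast_add_one_ne_zero _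
  have hNi : Function.Injective fun l => (N l).1 1 1 := fun l l' h => by
    simpa [hN, Fin.ext_iff] using h
  choose s hs using fun l => exists_transvectionCongr_apply_self_eq (N l).2 (i := 0) (hN0 l)
    ((M' l).1 0 0)
  let L : Fin k → Point (m + 2) K := fun l => ⟨_, isSymm_transvectionCongr (N l).2 0 1 (s l)⟩
  have hNL : ∀ l, ElemCongr (· ≠ 1) (N l).1 (L l).1 := fun l => .single h10.symm h10.symm (s l) _
  have hL : ∀ l, (L l).1 0 0 = (M' l).1 0 0 := hs
  have hLM : ∀ l, ElemCongr (· ≠ 0) (L l).1 (M' l).1 := fun l =>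
    elemCongr_of_zero_zero_eq (L l).2 (M' l).2
      ((hNL l).rank_eq.trans ((hMN l).rank_eq.trans (hrank l)))
      ((hNL l).det_eq.trans ((hMN l).det_eq.trans (hdet l))) (hL l) (hM0' l)
  obtain ⟨g₁, hg₁, h₁⟩ := exists_mem_Gsym_of_elemCongr hM hMN
  obtain ⟨g₂, hg₂, h₂⟩ := exists_mem_Gsym_of_elemCongr hNi hNL
  -- The `(0, 0)` entries of `L` are those of `M'`, hence distinct, and can be labels again.
  obtain ⟨g₃, hg₃, h₃⟩ := exists_mem_Gsym_of_elemCongr (by simpa only [hL] using hM') hLM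
  exact ⟨g₃ * (g₂ * g₁), mul_mem hg₃ (mul_mem hg₂ hg₁), fun l => by
    rw [mul_smul, mul_smul, h₁, h₂, h₃]⟩

/-- Elements of `Gsym` preserve rank and determinant. -/
theorem rank_det_smul_of_mem_Gsym {n : ℕ} {K : Type*} [Field K] [CharZero K] {g : Aut n K}
    (hg : g ∈ Gsym n K) :
    ∀ M : Point n K, (g • M).1.rank = M.1.rank ∧ (g • M).1.det = M.1.det := by
  induction hg using Subgroup.closure_induction with
  | mem g hg =>
    obtain ⟨i, j, hij, f, hf, t, rfl⟩ := hg
    intro M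
    rw [exp_replica_smul hij hf]
    exact ⟨rank_transvectionCongr hij _ _, det_transvectionCongr hij _ _⟩
  | one => simp
  | mul g h _ _ hg hh =>
    intro M
    rw [mul_smul]
    exact ⟨(hg _).1.trans (hh M).1, (hg _).2.trans (hh M).2⟩
  | inv g _ hg =>
    intro M
    have := hg (g⁻¹ • M)
    rw [smul_inv_smul] at this
    exact ⟨this.1.symm, this.2.symm⟩

end SymMat

theorem theorem3p5 {K : Type*} [Field K] [IsAlgClosed K] [CharZero K] (n : ℕ) (hn : 2 ≤ n)
    (k : ℕ) (M M' : Fin k → SymMat.Point n K)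
    (hM : Function.Injective M) (hM' : Function.Injective M')
    (hrank : ∀ i, (M i).1.rank = (M' i).1.rank) (hrank2 : ∀ i, 2 ≤ (M i).1.rank)
    (hdet : ∀ i, (M i).1.det = (M' i).1.det) :
    ∃ g ∈ SymMat.Gsym n K, ∀ i, g • M i = M' i := by
  obtain ⟨m, rfl⟩ := Nat.exists_eq_add_of_le' hn
  have h0 : ∀ l, (M l).1 ≠ 0 := fun l h => by
    have := hrank2 l
    rw [h, Matrix.rank_zero] at this
    omega
  have h0' : ∀ l, (M' l).1 ≠ 0 := fun l h => by
    have := hrank2 l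
    rw [hrank, h, Matrix.rank_zero] at this
    omega
  obtain ⟨g, hg, hgi, hg0⟩ := SymMat.exists_mem_Gsym_generic hM h0
  obtain ⟨g', hg', hgi', hg0'⟩ := SymMat.exists_mem_Gsym_generic hM' h0'
  have hinv := SymMat.rank_det_smul_of_mem_Gsym hg
  have hinv' := SymMat.rank_det_smul_of_mem_Gsym hg'
  -- Both tuples are in general position, and their ranks and determinants still match because `g`
  -- and `g'` preserve them.
  obtain ⟨f, hf, h⟩ := SymMat.exists_mem_Gsym_of_injective_zero_zero
    (M := fun l => g • M l) (M' := fun l => g' • M' l) hgi hg0 hgi' hg0'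
    (fun l => (hinv _).1.trans ((hrank l).trans (hinv' _).1.symm))
    (fun l => (hinv _).2.trans ((hdet l).trans (hinv' _).2.symm))
  exact ⟨g'⁻¹ * (f * g), mul_mem (inv_mem hg') (mul_mem hf hg), fun l => by
    rw [mul_smul, mul_smul, h, inv_smul_smul]⟩
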